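/- **Lemma 3.1.** Let $\mathbf{k}$ be a local field of characteristic zero, i.e. $\mathbb{R}$, $\mathbb{C}$, or a $p$-adic field (a finite extension of $\mathbb{Q}_p$ for some prime $p$). Let $\mathbf{G}$ be a linear algebraic $\mathbf{k}$-group, i.e. an affine group scheme of finite type over $\mathbf{k}$, and let $G=\mathbf{G}(\mathbf{k})$ be its group of $\mathbf{k}$-points. If $\mathbf{k}=\mathbb{R}$ or $\mathbb{C}$, endow $G$ with the topology induced by that of $\mathbf{k}$, i.e. the coarsest topology for which every regular function on $\mathbf{G}$ is continuous on $G$. A torsion subgroup is a subgroup all of whose elements have finite order. 1. If $\mathbf{k}$ is a $p$-adic field, then every torsion subgroup of $G$ is finite. 2. If $\mathbf{k}=\mathbb{R}$ or $\mathbb{C}$, then every torsion subgroup of $G$ that is discrete (for the topology induced by $G$) is finite. -/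

import Mathlib

/-- The group `G(k)` of `k`-points of the affine algebraic `k`-group `G = Spec A`, where `A` is a
finitely generated commutative Hopf algebra over `k`: a point is a `k`-algebra homomorphism
`A → k`, and the group law (Mathlib's convolution product) is induced by the comultiplication,
the counit and the antipode of `A`. -/
abbrev RationalPoints (k : Type*) (A : Type*) [Field k] [CommRing A] [HopfAlgebra k A] : Type _ :=
  WithConv (A →ₐ[k] k)

/-- The topology of `G(k)` coming from the topology of `k`: the coarsest one for which every
regular function `a ∈ A = k[G]` is continuous as a map `G(k) → k`. It is the topology induced by
any closed embedding of `G` into an affine space. -/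
instance RationalPoints.instTopologicalSpace (k : Type*) (A : Type*) [Field k]
    [TopologicalSpace k] [CommRing A] [HopfAlgebra k A] :
    TopologicalSpace (RationalPoints k A) :=
  TopologicalSpace.induced (fun (g : RationalPoints k A) (a : A) => g.ofConv a)
    Pi.topologicalSpace

/-! The right translates of generators of `A` span a finite-dimensional space, so `Γ` has a faithful
matrix representation `ρ` in which the generators are linear in the matrix.

Over a `p`-adic field, elements of finite order in a finite-dimensional algebra have a common
exponent `N`, so traces on `Γ` are sums of `n` roots of unity of order dividing `N` and take
finitely many values. By Burnside's argument (`Matrix.finite_of_finite_trace`) `Γ` is finite.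

Over `ℝ` or `ℂ`, finitely many elements already span `ρ(Γ)` linearly. They generate a finite group
by Schur's theorem, itself deduced from the `2`-adic case. That group is unitarizable, so the trace
form is nondegenerate on the span and the entries of `ρ g` are linear functions of boundedly many
traces, each of norm at most `n`. Hence `Γ` is bounded; if infinite, it accumulates at `1`,
contradicting discreteness. -/

namespace Matrix

/-! ### Traces of matrices of finite order and Burnside's finiteness criterion. -/

variable {K : Type*} [Field K] {n : Type*} [Fintype n] [DecidableEq n]

/-- A matrix of finite order over a field of characteristic zero, all of whose powers have the
trace of the identity, is the identity. -/
theorem eq_one_of_trace_pow_eq [CharZero K] {u : Matrix n n K} {N : ℕ} (hN : N ≠ 0)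
    (hu : u ^ N = 1) (htr : ∀ k : ℕ, (u ^ k).trace = Fintype.card n) : u = 1 := by
  have hN' : (N : K) ≠ 0 := Nat.cast_ne_zero.2 hN
  -- `P` projects onto the fixed vectors of `u`. The idempotent `1 - P` has trace `0`, which in
  -- characteristic zero is its rank.
  set P : Matrix n n K := (N : K)⁻¹ • ∑ k ∈ Finset.range N, u ^ k with hP
  have huP : u * P = P := by
    have h := Finset.sum_range_succ (fun k => u ^ k) N
    rw [Finset.sum_range_succ'] at h
    rw [hP, mul_smul_comm, Finset.mul_sum]
    congr 1
    simpa [hu, pow_succ'] using h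
  have hukP : ∀ k : ℕ, u ^ k * P = P := by
    intro k
    induction k with
    | zero => simp
    | succ k ih => rw [pow_succ, mul_assoc, huP, ih]
  have hPP : P * P = P := by
    conv_lhs => rw [hP]
    rw [smul_mul_assoc, Finset.sum_mul, Finset.sum_congr rfl (fun k _ => hukP k)]
    simp [← Nat.cast_smul_eq_nsmul K, smul_smul, hN']
  have htrP : (1 - P).trace = 0 := by
    rw [trace_sub, hP, trace_smul, trace_sum, Finset.sum_congr rfl (fun k _ => htr k)]
    simp [hN']
  have hid : IsIdempotentElem (1 - P) := IsIdempotentElem.one_sub hPP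
  have hlin : IsIdempotentElem (toLin' (1 - P)) := by
    rw [IsIdempotentElem, Module.End.mul_eq_comp, ← toLin'_mul, hid.eq]
  have h0 := LinearMap.IsIdempotentElem.eq_zero_of_trace_eq_zero hlin (by simpa using htrP)
  have hP1 : P = 1 := by
    exact (sub_eq_zero.1 ((map_eq_zero_iff _ toLin'.injective).1 h0)).symm
  rw [hP1, mul_one] at huP
  exact huP

/-- The trace of a matrix with `u ^ N = 1` is, over an algebraic closure, a sum of roots of
unity of order dividing `N`. -/
theorem exists_multiset_rootsOfUnity_sum_eq_trace {u : Matrix n n K} {N : ℕ} (hu : u ^ N = 1) :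
    ∃ s : Multiset (AlgebraicClosure K), s.card = Fintype.card n ∧ (∀ x ∈ s, x ^ N = 1) ∧
      algebraMap K (AlgebraicClosure K) u.trace = s.sum := by
  set v := u.map (algebraMap K (AlgebraicClosure K)) with hv
  have hvN : v ^ N = 1 := by
    rw [hv, ← RingHom.mapMatrix_apply, ← map_pow, hu, map_one]
  refine ⟨v.charpoly.roots, ?_, fun x hx => ?_, ?_⟩
  · rw [IsAlgClosed.card_roots_eq_natDegree, charpoly_natDegree_eq_dim]
  · have hx' : Module.End.HasEigenvalue (toLin' v) x := by
      rw [Module.End.hasEigenvalue_iff_isRoot_charpoly, charpoly_toLin']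
      exact Polynomial.isRoot_of_mem_roots hx
    obtain ⟨w, hw⟩ := hx'.exists_hasEigenvector
    have h1 := hw.pow_apply N
    rw [← toLin'_pow, hvN, toLin'_one, LinearMap.id_apply] at h1
    have h2 : (x ^ N - 1) • w = 0 := by rw [sub_smul, ← h1, one_smul, sub_self]
    exact sub_eq_zero.1 ((smul_eq_zero.1 h2).resolve_right hw.2)
  · rw [← trace_eq_sum_roots_charpoly, hv, trace, trace, map_sum]
    rfl

theorem isIntegral_trace_of_pow_eq_one {u : Matrix n n K} {N : ℕ} (hN : N ≠ 0) (hu : u ^ N = 1)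
    (R : Type*) [CommRing R] [Algebra R K] : IsIntegral R u.trace := by
  obtain ⟨s, -, hs, hsum⟩ := exists_multiset_rootsOfUnity_sum_eq_trace hu
  rw [← isIntegral_algebraMap_iff (algebraMap K (AlgebraicClosure K)).injective, hsum]
  refine IsIntegral.multiset_sum fun x hx => ?_
  refine IsIntegral.of_pow (Nat.pos_of_ne_zero hN) ?_
  rw [hs x hx]
  exact isIntegral_one

theorem finite_trace_of_pow_eq_one {N : ℕ} (hN : N ≠ 0) :
    {t : K | ∃ u : Matrix n n K, u ^ N = 1 ∧ u.trace = t}.Finite := by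
  classical
  set F := (Polynomial.nthRoots N (1 : AlgebraicClosure K)).toFinset
  refine Set.Finite.of_finite_image (f := algebraMap K (AlgebraicClosure K)) ?_
    (algebraMap K (AlgebraicClosure K)).injective.injOn
  -- `Fintype.card n • F.val` repeats each root of unity often enough to contain every multiset of
  -- that size.
  refine (((Fintype.card n • F.val).powerset.map Multiset.sum).toFinset.finite_toSet).subset ?_
  rintro _ ⟨_, ⟨u, hu, rfl⟩, rfl⟩
  obtain ⟨s, hcard, hs, hsum⟩ := exists_multiset_rootsOfUnity_sum_eq_trace hu
  simp only [Finset.mem_coe, Multiset.mem_toFinset, Multiset.mem_map, Multiset.mem_powerset]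
  refine ⟨s, Multiset.le_iff_count.2 fun a => ?_, hsum.symm⟩
  by_cases ha : a ∈ s
  · have haF : a ∈ F := by
      simpa [F, Polynomial.mem_nthRoots (Nat.pos_of_ne_zero hN)] using hs a ha
    rw [Multiset.count_nsmul, Multiset.count_eq_one_of_mem F.nodup haF, mul_one, ← hcard]
    exact Multiset.count_le_card a s
  · simp [Multiset.count_eq_zero_of_notMem ha]

/-- The span of a faithful matrix group is spanned by finitely many group elements. -/
theorem exists_finite_span_image_eq {G : Type*} [Group G] (ρ : G →* Matrix n n K)
    (hρ : Function.Injective ρ) : ∃ S : Set G, S.Finite ∧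
      Submodule.span K (ρ '' S) = Submodule.span K (Set.range ρ) := by
  obtain ⟨t, ht, hts⟩ := (Submodule.fg_span_iff_fg_span_finset_subset (Set.range ρ)).1
    (IsNoetherian.noetherian (Submodule.span K (Set.range ρ)))
  obtain ⟨S, hS⟩ := Set.subset_range_iff_exists_image_eq.1 ht
  refine ⟨S, Set.Finite.of_finite_image (f := ρ) ?_ hρ.injOn, ?_⟩
  · rw [hS]; exact t.finite_toSet
  · rw [hS, hts]

/-- A torsion group of matrices in characteristic zero is finite as soon as the traces of its
elements take finitely many values. -/
theorem finite_of_finite_trace [CharZero K] {G : Type*} [Group G] (hG : IsMulTorsion G)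
    (ρ : G →* Matrix n n K) (hρ : Function.Injective ρ)
    (hfin : (Set.range fun g => (ρ g).trace).Finite) : Finite G := by
  classical
  obtain ⟨S, hS, hspan⟩ := exists_finite_span_image_eq ρ hρ
  have : Finite S := hS
  have : Finite (Set.range fun g => (ρ g).trace) := hfin
  -- Since `S` spans, the traces of `ρ (g * s)` determine the functional `x ↦ tr (ρ g * x)` on the
  -- whole span; the target of `τ` is finite.
  let τ : G → (S → Set.range fun g => (ρ g).trace) := fun g s => ⟨(ρ (g * s)).trace, g * s, rfl⟩
  refine Finite.of_injective τ fun g h hgh => ?_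
  have key : ∀ x ∈ Submodule.span K (Set.range ρ), (ρ g * x).trace = (ρ h * x).trace := by
    rw [← hspan]
    intro x hx
    induction hx using Submodule.span_induction with
    | mem x hx =>
      obtain ⟨s, hs, rfl⟩ := hx
      have := congrArg Subtype.val (congrFun hgh ⟨s, hs⟩)
      simpa [τ] using this
    | zero => simp
    | add x y _ _ hx hy => simp [mul_add, hx, hy]
    | smul c x _ hx => simp [hx]
  -- By `key`, the leading `g` in `(g * h⁻¹) ^ (k + 1)` may be replaced by `h` without changing the
  -- trace, which cancels one factor.
  have hpow : ∀ k : ℕ, (ρ (g * h⁻¹) ^ k).trace = Fintype.card n := by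
    intro k
    induction k with
    | zero => simp
    | succ k ih =>
      have := key (ρ (h⁻¹ * (g * h⁻¹) ^ k)) (Submodule.subset_span ⟨_, rfl⟩)
      rw [← map_mul, ← map_mul, mul_inv_cancel_left, ← mul_assoc, ← pow_succ'] at this
      rw [← map_pow, this, map_pow, ih]
  obtain ⟨N, hN, hpN⟩ := (isOfFinOrder_iff_pow_eq_one.1 (hG (g * h⁻¹)))
  have h1 := eq_one_of_trace_pow_eq hN.ne' (by rw [← map_pow, hpN, map_one]) hpow
  rw [← map_one ρ] at h1
  exact mul_inv_eq_one.1 (hρ h1)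

end Matrix

/-! ### A common exponent for elements of finite order in `p`-adic algebras. -/

/-- If `1 + p ^ 2 * y` has finite order in a `p`-adically separated commutative ring without
`p`-torsion, then it equals `1`. -/
theorem eq_one_of_isOfFinOrder_of_sq_dvd_sub_one {R : Type*} [CommRing R] {p : ℕ} (hp : p.Prime)
    (htf : ∀ x : R, (p : R) * x = 0 → x = 0) (hsep : ∀ x : R, (∀ k : ℕ, (p : R) ^ k ∣ x) → x = 0)
    {u : R} (hu : IsOfFinOrder u) (hpu : (p : R) ^ 2 ∣ u - 1) : u = 1 := by
  by_contra hne
  have ho : orderOf u ≠ 1 := fun h => hne (orderOf_eq_one_iff.1 h)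
  obtain ⟨l, hl, hlo⟩ := Nat.exists_prime_and_dvd ho
  obtain ⟨m, hm⟩ := hlo
  have hpos : 0 < orderOf u := hu.orderOf_pos
  set v := u ^ m with hv
  have hvl : v ^ l = 1 := by rw [hv, ← pow_mul, mul_comm, ← hm, pow_orderOf_eq_one]
  have hv1 : v ≠ 1 := by
    intro h
    have h1 := orderOf_dvd_of_pow_eq_one h
    have hm0 : 0 < m := Nat.pos_of_ne_zero (by rintro rfl; omega)
    have h2 := Nat.le_of_dvd hm0 h1
    have := hl.two_le
    nlinarith
  have hpv : (p : R) ^ 2 ∣ v - 1 := hpu.trans (sub_one_dvd_pow_sub_one u m)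
  have hz : v - 1 ≠ 0 := sub_ne_zero.2 hv1
  have hex : ∃ k : ℕ, ¬ (p : R) ^ k ∣ v - 1 := by
    by_contra! h
    exact hz (hsep _ h)
  classical
  set k := Nat.find hex
  have hk : ¬ (p : R) ^ k ∣ v - 1 := Nat.find_spec hex
  have hk3 : 3 ≤ k := by
    by_contra! h
    exact hk ((pow_dvd_pow _ (by omega)).trans hpv)
  -- Thus `p ^ (j + 1)` is the highest power of `p` dividing `v - 1`, and `j ≥ 1`.
  obtain ⟨j, hj⟩ : ∃ j, k = j + 2 := ⟨k - 2, by omega⟩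
  have hjk : (p : R) ^ (j + 1) ∣ v - 1 := by
    by_contra h
    exact Nat.find_min hex (m := j + 1) (by omega) h
  have htfpow : ∀ (i : ℕ) (x : R), (p : R) ^ i * x = 0 → x = 0 := by
    intro i
    induction i with
    | zero => simp
    | succ i ih => intro x hx; exact htf _ (ih _ (by rw [← mul_assoc, ← pow_succ, hx]))
  obtain ⟨x, hx⟩ := hjk
  obtain ⟨w, hw⟩ := Polynomial.powAddExpansion 1 (v - 1) l
  rw [add_sub_cancel, hvl] at hw
  have hmain : (l : R) * x + w * (p : R) ^ (j + 1) * x ^ 2 = 0 := by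
    apply htfpow (j + 1)
    rw [hx] at hw
    simp only [one_pow] at hw
    linear_combination -hw
  -- For `l = p` a factor `p ^ j` survives division by `p`, so `j ≥ 1` is essential: with `p` in
  -- place of `p ^ 2`, `u = -1` in `ℤ_[2]` is a counterexample.
  have hdvd : (p : R) ∣ x := by
    by_cases hlp : l = p
    · subst hlp
      have h0 : x + w * (l : R) ^ j * x ^ 2 = 0 := by
        apply htf
        linear_combination hmain
      obtain ⟨i, rfl⟩ : ∃ i, j = i + 1 := ⟨j - 1, by omega⟩
      exact ⟨-(w * (l : R) ^ i * x ^ 2), by linear_combination h0⟩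
    · have hcop : IsCoprime (l : ℤ) (p : ℤ) :=
        Nat.isCoprime_iff_coprime.2 ((Nat.coprime_primes hl hp).2 hlp)
      obtain ⟨a, b, hab⟩ := hcop
      have hab' : (a : R) * l + b * p = 1 := by exact_mod_cast congrArg (Int.cast : ℤ → R) hab
      exact ⟨b * x - a * w * (p : R) ^ j * x ^ 2, by
        linear_combination (-x) * hab' + (a : R) * hmain⟩
  obtain ⟨y, hy⟩ := hdvd
  exact hk ⟨y, by rw [hx, hy, hj]; ring⟩

theorem PadicInt.eq_zero_of_forall_pow_dvd {p : ℕ} [Fact p.Prime] {x : ℤ_[p]}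
    (h : ∀ k : ℕ, (p : ℤ_[p]) ^ k ∣ x) : x = 0 := by
  by_contra hx
  have := (FiniteMultiplicity.of_not_isUnit (PadicInt.prime_p (p := p)).not_isUnit hx)
  obtain ⟨k, hk⟩ := this
  exact hk (h _)

open Module in
/-- Elements of finite order of a finite free commutative `ℤ_[p]`-algebra have order bounded in
terms of the rank: they embed into the units modulo `p ^ 2`. -/
theorem PadicInt.pow_factorial_eq_one_of_isOfFinOrder {p : ℕ} [Fact p.Prime] {R : Type*}
    [CommRing R] [Algebra ℤ_[p] R] [Module.Finite ℤ_[p] R] [Module.Free ℤ_[p] R] {x : R}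
    (hx : IsOfFinOrder x) : x ^ ((p ^ 2) ^ finrank ℤ_[p] R).factorial = 1 := by
  have hp : p.Prime := Fact.out
  have : NeZero (p ^ 2) := ⟨pow_ne_zero _ hp.ne_zero⟩
  let b := finBasis ℤ_[p] R
  have hcast : ∀ (k : ℕ) (y : R), (p : R) ^ k * y = ((p : ℤ_[p]) ^ k) • y := by
    intro k y
    rw [Algebra.smul_def]
    simp
  -- Pigeonhole on coordinates modulo `p ^ 2`: two powers of `x` with exponents at most `(p ^ 2) ^
  -- finrank` are congruent, so their quotient is `1`, and the difference of exponents divides the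
  -- factorial.
  let c : ℕ → (Fin (finrank ℤ_[p] R) → ZMod (p ^ 2)) :=
    fun i j => PadicInt.toZModPow 2 (b.repr (x ^ i) j)
  obtain ⟨i, hi, j, hj, hij, hc⟩ : ∃ i ∈ Finset.range ((p ^ 2) ^ finrank ℤ_[p] R + 1),
      ∃ j ∈ Finset.range ((p ^ 2) ^ finrank ℤ_[p] R + 1), i ≠ j ∧ c i = c j :=
    Finset.exists_ne_map_eq_of_card_lt_of_maps_to (t := Finset.univ)
      (by simp [ZMod.card]) (fun _ _ => Finset.mem_univ _)
  wlog hlt : i < j generalizing i j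
  · exact this j hj i hi hij.symm hc.symm (by omega)
  rw [Finset.mem_range] at hi hj
  have hdvd : (p : R) ^ 2 ∣ x ^ j - x ^ i := by
    have h : ∀ l, ∃ a, b.repr (x ^ j - x ^ i) l = (p : ℤ_[p]) ^ 2 * a := by
      intro l
      have h1 : b.repr (x ^ j - x ^ i) l ∈ RingHom.ker (PadicInt.toZModPow (p := p) 2) := by
        rw [RingHom.mem_ker, map_sub, Finsupp.sub_apply, map_sub, sub_eq_zero]
        exact (congrFun hc l).symm
      rw [PadicInt.ker_toZModPow, Ideal.mem_span_singleton] at h1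
      exact h1
    choose a ha using h
    refine ⟨∑ l, a l • b l, ?_⟩
    rw [hcast, Finset.smul_sum, ← b.sum_repr (x ^ j - x ^ i)]
    exact Finset.sum_congr rfl fun l _ => by rw [ha l, smul_smul]
  have hunit : IsUnit (x ^ i) := hx.isUnit.pow i
  have hdvd' : (p : R) ^ 2 ∣ x ^ (j - i) - 1 := by
    obtain ⟨y, hy⟩ := hunit.exists_right_inv
    have h2 : x ^ j = x ^ (j - i) * x ^ i := by rw [← pow_add]; congr 1; omega
    have h3 : x ^ (j - i) - 1 = (x ^ j - x ^ i) * y := by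
      rw [h2]; linear_combination (1 - x ^ (j - i)) * hy
    exact h3 ▸ hdvd.mul_right y
  have hone : x ^ (j - i) = 1 := by
    refine eq_one_of_isOfFinOrder_of_sq_dvd_sub_one hp (fun y hy => ?_) (fun y hy => ?_)
      hx.pow hdvd'
    · have h1 := hcast 1 y
      rw [pow_one, pow_one, hy] at h1
      exact (smul_eq_zero.1 h1.symm).resolve_left (by exact_mod_cast hp.ne_zero)
    · refine b.repr.map_eq_zero_iff.1 (Finsupp.ext fun l => ?_)
      refine PadicInt.eq_zero_of_forall_pow_dvd fun k => ?_
      obtain ⟨z, rfl⟩ := hy k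
      rw [hcast, map_smul]
      exact ⟨_, rfl⟩
  obtain ⟨d, hd⟩ := Nat.dvd_factorial (m := j - i) (n := (p ^ 2) ^ finrank ℤ_[p] R)
    (by omega) (by omega)
  rw [hd, pow_mul, hone, one_pow]

open Module in
/-- The elements of finite order of a finite-dimensional `ℚ_[p]`-algebra have a common
exponent. -/
theorem Padic.exists_pow_eq_one_of_isOfFinOrder (p : ℕ) [Fact p.Prime] (E : Type*) [Ring E]
    [Algebra ℚ_[p] E] [FiniteDimensional ℚ_[p] E] :
    ∃ N : ℕ, N ≠ 0 ∧ ∀ x : E, IsOfFinOrder x → x ^ N = 1 := by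
  let : Algebra ℤ_[p] E := Algebra.compHom E (algebraMap ℤ_[p] ℚ_[p])
  have : IsScalarTower ℤ_[p] ℚ_[p] E := IsScalarTower.of_algebraMap_eq fun _ => rfl
  refine ⟨((p ^ 2) ^ finrank ℚ_[p] E).factorial, Nat.factorial_ne_zero _, fun x hx => ?_⟩
  obtain ⟨o, ho, hxo⟩ := isOfFinOrder_iff_pow_eq_one.1 hx
  have hint : IsIntegral ℤ_[p] x := IsIntegral.of_pow ho (hxo ▸ isIntegral_one)
  -- `ℤ_[p][x]` is commutative, finite because `x` is integral, and torsion-free, hence free of rank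
  -- at most `dim E`.
  let R := Algebra.adjoin ℤ_[p] {x}
  have : IsMulCommutative R := Algebra.isMulCommutative_adjoin ℤ_[p] (by rintro _ rfl _ rfl; rfl)
  have : Module.Finite ℤ_[p] R := Module.Finite.iff_fg.2 hint.fg_adjoin_singleton
  have : IsTorsionFree ℤ_[p] E := by
    constructor
    intro r hr y z hyz
    have hr' : algebraMap ℤ_[p] ℚ_[p] r ≠ 0 :=
      (map_ne_zero_iff _ (FaithfulSMul.algebraMap_injective ℤ_[p] ℚ_[p])).2 hr.ne_zero
    simp only [← algebraMap_smul ℚ_[p] r] at hyz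
    exact smul_right_injective E hr' hyz
  have : Module.Free ℤ_[p] R := inferInstance
  let y : R := ⟨x, Algebra.self_mem_adjoin_singleton _ _⟩
  have hy : IsOfFinOrder y := isOfFinOrder_iff_pow_eq_one.2 ⟨o, ho, Subtype.ext hxo⟩
  have h := PadicInt.pow_factorial_eq_one_of_isOfFinOrder (p := p) hy
  have hrank : finrank ℤ_[p] R ≤ finrank ℚ_[p] E := by
    have hli : LinearIndependent ℤ_[p] (fun i => (finBasis ℤ_[p] R i : E)) :=
      (finBasis ℤ_[p] R).linearIndependent.map' R.val.toLinearMap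
        (LinearMap.ker_eq_bot.2 Subtype.val_injective)
    have := ((LinearIndependent.iff_fractionRing ℤ_[p] ℚ_[p]).1 hli).fintype_card_le_finrank
    simpa using this
  have h' : x ^ ((p ^ 2) ^ finrank ℤ_[p] R).factorial = 1 := congrArg Subtype.val h
  obtain ⟨d, hd⟩ := Nat.factorial_dvd_factorial
    (Nat.pow_le_pow_right (pow_pos (Fact.out : p.Prime).pos 2) hrank)
  rw [hd, pow_mul, h', one_pow]

/-! ### Torsion matrix groups over `p`-adic fields, and Schur's theorem. -/

namespace Matrix

open scoped TensorProduct

variable {n : Type*} [Fintype n] [DecidableEq n]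

/-- Torsion matrix groups over a `p`-adic field are finite. -/
theorem finite_of_isMulTorsion_of_padic (p : ℕ) [Fact p.Prime] {k : Type*} [Field k]
    [Algebra ℚ_[p] k] [FiniteDimensional ℚ_[p] k] {G : Type*} [Group G] (hG : IsMulTorsion G)
    (ρ : G →* Matrix n n k) (hρ : Function.Injective ρ) : Finite G := by
  have : CharZero k := charZero_of_injective_algebraMap (algebraMap ℚ_[p] k).injective
  obtain ⟨N, hN, h⟩ := Padic.exists_pow_eq_one_of_isOfFinOrder p (Matrix n n k)
  refine finite_of_finite_trace hG ρ hρ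
    ((finite_trace_of_pow_eq_one (n := n) hN).subset ?_)
  rintro _ ⟨g, rfl⟩
  exact ⟨ρ g, h _ (ρ.isOfFinOrder (hG g)), rfl⟩

/-- A nontrivial finitely generated algebra over `ℚ` maps to some `p`-adic field. -/
theorem exists_ringHom_padic_field.{u} (B : Type u) [CommRing B] [Nontrivial B] [Algebra ℚ B]
    [Algebra.FiniteType ℚ B] (p : ℕ) [Fact p.Prime] :
    ∃ (k : Type u) (_ : Field k) (_ : Algebra ℚ_[p] k),
      FiniteDimensional ℚ_[p] k ∧ Nonempty (B →+* k) := by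
  -- By the Nullstellensatz, the residue field at `m` is finite over `ℚ_[p]`.
  obtain ⟨m, hm⟩ := Ideal.exists_maximal (ℚ_[p] ⊗[ℚ] B)
  let := Ideal.Quotient.field m
  refine ⟨(ℚ_[p] ⊗[ℚ] B) ⧸ m, inferInstance, inferInstance,
    finite_of_finite_type_of_isJacobsonRing ℚ_[p] _, ⟨?_⟩⟩
  exact (Ideal.Quotient.mk m).comp
    (Algebra.TensorProduct.includeRight : B →ₐ[ℚ] ℚ_[p] ⊗[ℚ] B).toRingHom

/-- **Schur's theorem**: finitely generated torsion matrix groups in characteristic zero are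
finite. -/
theorem finite_of_isMulTorsion_of_fg {K : Type*} [Field K] [CharZero K] {G : Type*} [Group G]
    [Group.FG G] (hG : IsMulTorsion G) (ρ : G →* Matrix n n K) (hρ : Function.Injective ρ) :
    Finite G := by
  -- With monoid generators, the ring generated by their entries contains all entries of `ρ`; no
  -- inverses are needed.
  obtain ⟨S, hS⟩ := (Monoid.fg_iff.1 (Group.fg_iff_monoid_fg.1 ‹_›) :
    ∃ S : Set G, Submonoid.closure S = ⊤ ∧ S.Finite)
  obtain ⟨hS, hSfin⟩ := hS
  let T : Set K := ⋃ s ∈ S, Set.range fun ij : n × n => ρ s ij.1 ij.2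
  have hT : T.Finite := hSfin.biUnion fun s _ => Set.finite_range _
  let B := Algebra.adjoin ℚ T
  have : Algebra.FiniteType ℚ B := Subalgebra.fg_iff_finiteType B |>.1 ⟨hT.toFinset, by simp [B]⟩
  have hmem : ∀ (g : G), ρ g ∈ (B.val : B →+* K).mapMatrix (m := n).range := by
    intro g
    have hg : g ∈ Submonoid.closure S := hS ▸ Submonoid.mem_top g
    induction hg using Submonoid.closure_induction with
    | mem s hs =>
      exact ⟨fun i j => ⟨ρ s i j, Algebra.subset_adjoin (Set.mem_biUnion hs ⟨(i, j), rfl⟩)⟩, rfl⟩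
    | one => rw [map_one]; exact one_mem _
    | mul x y _ _ hx hy => rw [map_mul]; exact mul_mem hx hy
  have hinj : Function.Injective ((B.val : B →+* K).mapMatrix (m := n)) := by
    intro M M' h
    ext i j
    exact congrFun (congrFun h i) j
  choose σ hσ using hmem
  let ρB : G →* Matrix n n B :=
    { toFun := σ
      map_one' := hinj (by rw [hσ, map_one, map_one])
      map_mul' := fun g h => hinj (by rw [hσ, map_mul, map_mul, hσ, hσ]) }
  obtain ⟨k, _, _, _, ⟨φ⟩⟩ := exists_ringHom_padic_field B 2
  -- `φ` need not be injective, but a nonzero element of the domain `B` algebraic over `ℚ` is a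
  -- unit. The differences between traces of torsion elements and the matrix size are such algebraic
  -- elements, so `φ` detects when they vanish.
  have hφ : ∀ c : B, IsIntegral ℚ c → φ c = 0 → c = 0 := by
    intro c hc h0
    by_contra hne
    have hu : IsUnit c := hc.isUnit hne
    exact (hu.map φ).ne_zero h0
  let ρk : G →* Matrix n n k := φ.mapMatrix.toMonoidHom.comp ρB
  refine finite_of_isMulTorsion_of_padic 2 hG ρk fun g h hgh => ?_
  have hker : ρk (g * h⁻¹) = 1 := by
    rw [map_mul, hgh, ← map_mul, mul_inv_cancel, map_one]
  obtain ⟨N, hN, hpN⟩ := isOfFinOrder_iff_pow_eq_one.1 (hG (g * h⁻¹))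
  have htr : ∀ k : ℕ, (ρ (g * h⁻¹) ^ k).trace = Fintype.card n := by
    intro k
    have h1 : (ρB ((g * h⁻¹) ^ k)).trace - Fintype.card n = 0 := by
      have hval : ((ρB ((g * h⁻¹) ^ k)).trace : K) = (ρ ((g * h⁻¹) ^ k)).trace := by
        rw [← hσ, trace, trace]
        simp [ρB]
      apply hφ
      · refine IsIntegral.sub ?_ (isIntegral_natCast _)
        rw [← isIntegral_algebraMap_iff (B := K) Subtype.val_injective]
        change IsIntegral ℚ ((ρB ((g * h⁻¹) ^ k)).trace : K)
        rw [hval]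
        refine isIntegral_trace_of_pow_eq_one hN.ne' ?_ ℚ
        rw [← map_pow, pow_right_comm, hpN, one_pow, map_one]
      · have h2 : φ (ρB ((g * h⁻¹) ^ k)).trace = (ρk ((g * h⁻¹) ^ k)).trace := by
          rw [trace, map_sum]; rfl
        rw [map_sub, h2, map_pow, hker, one_pow, trace_one, map_natCast, sub_self]
    have h3 := congrArg (Subtype.val) (sub_eq_zero.1 h1)
    rw [← map_pow, ← hσ, trace]
    simpa [ρB, trace] using h3
  have h1 := eq_one_of_trace_pow_eq hN.ne' (by rw [← map_pow, hpN, map_one]) htr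
  rw [← map_one ρ] at h1
  exact mul_inv_eq_one.1 (hρ h1)

end Matrix

/-! ### Unitarizability and the trace form over `ℝ` and `ℂ`. -/

namespace Matrix

variable {k : Type*} [RCLike k] {n : Type*} [Fintype n] [DecidableEq n]

open scoped MatrixOrder ComplexOrder Matrix.Norms.L2Operator in
/-- A finite group of real or complex matrices is conjugate into the unitary group. -/
theorem exists_conj_mem_unitaryGroup {H : Type*} [Group H] [Finite H] (ρ : H →* Matrix n n k) :
    ∃ T : (Matrix n n k)ˣ, ∀ h, (T : Matrix n n k) * ρ h * (T⁻¹ : (Matrix n n k)ˣ) ∈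
      unitaryGroup n k := by
  have := Fintype.ofFinite H
  -- Weyl averaging: `S` is an invariant positive definite form, and a factorization `S = T* T`
  -- supplies the conjugating matrix.
  set S : Matrix n n k := ∑ h, (ρ h)ᴴ * ρ h with hS
  have hinj : ∀ h, Function.Injective (ρ h).mulVec := fun h =>
    mulVec_injective_iff_isUnit.2 ((Group.isUnit h).map ρ)
  have hpos : S.PosDef :=
    posDef_sum Finset.univ_nonempty fun h _ => PosDef.conjTranspose_mul_self _ (hinj h)
  obtain ⟨y, hy, hSy⟩ := CStarAlgebra.isStrictlyPositive_iff_eq_star_mul_self.mp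
    hpos.isStrictlyPositive
  obtain ⟨T, rfl⟩ := hy
  have hinv : ∀ h, (ρ h)ᴴ * S * ρ h = S := by
    intro h
    rw [hS, Finset.mul_sum, Finset.sum_mul]
    refine Fintype.sum_equiv (Equiv.mulRight h) _ _ fun g => ?_
    simp [conjTranspose_mul, mul_assoc]
  refine ⟨T, fun h => mem_unitaryGroup_iff'.2 ?_⟩
  have h1 : star (T : Matrix n n k) * T = S := hSy.symm
  have h2 : star ((T⁻¹ : (Matrix n n k)ˣ) : Matrix n n k) * star (T : Matrix n n k) = 1 := by
    rw [← star_mul, Units.mul_inv, star_one]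
  calc star ((T : Matrix n n k) * ρ h * (T⁻¹ : (Matrix n n k)ˣ)) *
        ((T : Matrix n n k) * ρ h * (T⁻¹ : (Matrix n n k)ˣ))
      = star ((T⁻¹ : (Matrix n n k)ˣ) : Matrix n n k) * ((ρ h)ᴴ *
        (star (T : Matrix n n k) * T) * ρ h) * (T⁻¹ : (Matrix n n k)ˣ) := by
          simp only [star_mul, star_eq_conjTranspose, mul_assoc]
    _ = 1 := by rw [h1, hinv, ← h1, ← mul_assoc, h2, one_mul, Units.mul_inv]

/-- The trace of a real or complex matrix of finite order is at most its size. -/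
theorem norm_trace_le_card_of_isOfFinOrder {G : Type*} [Group G] (hG : IsMulTorsion G)
    (ρ : G →* Matrix n n k) (g : G) : ‖(ρ g).trace‖ ≤ Fintype.card n := by
  have : Finite (Subgroup.zpowers g) := finite_zpowers.2 (hG g)
  obtain ⟨T, hT⟩ := exists_conj_mem_unitaryGroup (ρ.comp (Subgroup.zpowers g).subtype)
  have h := hT ⟨g, Subgroup.mem_zpowers g⟩
  have htr : ((T : Matrix n n k) * ρ g * (T⁻¹ : (Matrix n n k)ˣ)).trace = (ρ g).trace := by
    rw [trace_mul_comm, ← mul_assoc, Units.inv_mul, one_mul]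
  rw [← htr, trace]
  refine (norm_sum_le _ _).trans ?_
  refine (Finset.sum_le_card_nsmul _ _ 1 fun i _ => entry_norm_bound_of_unitary h i i).trans ?_
  simp

/-- The trace form is nondegenerate on the span of a finite group of real or complex matrices. -/
theorem eq_zero_of_mem_span_of_trace_mul_eq_zero {H : Type*} [Group H] [Finite H]
    (ρ : H →* Matrix n n k) {x : Matrix n n k} (hx : x ∈ Submodule.span k (Set.range ρ))
    (htr : ∀ h, (x * ρ h).trace = 0) : x = 0 := by
  obtain ⟨T, hT⟩ := exists_conj_mem_unitaryGroup ρ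
  -- After conjugation by `T` the span is closed under adjoints, since `ρ h` becomes unitary. The
  -- adjoint of `x` is then an allowed test element, and `tr (x x*) = 0` forces `x = 0`.
  have hstar : ∀ y ∈ Submodule.span k (Set.range ρ),
      ∃ z ∈ Submodule.span k (Set.range ρ),
        star ((T : Matrix n n k) * y * (T⁻¹ : (Matrix n n k)ˣ)) =
          (T : Matrix n n k) * z * (T⁻¹ : (Matrix n n k)ˣ) := by
    intro y hy
    induction hy using Submodule.span_induction with
    | mem y hy =>
      obtain ⟨h, rfl⟩ := hy
      refine ⟨ρ h⁻¹, Submodule.subset_span ⟨_, rfl⟩, ?_⟩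
      refine left_inv_eq_right_inv (mem_unitaryGroup_iff'.1 (hT h)) ?_
      calc (T : Matrix n n k) * ρ h * (T⁻¹ : (Matrix n n k)ˣ) *
            ((T : Matrix n n k) * ρ h⁻¹ * (T⁻¹ : (Matrix n n k)ˣ))
          = (T : Matrix n n k) * (ρ h * (((T⁻¹ : (Matrix n n k)ˣ) : Matrix n n k) * T) * ρ h⁻¹) *
            ((T⁻¹ : (Matrix n n k)ˣ) : Matrix n n k) := by
            simp only [mul_assoc]
        _ = 1 := by rw [Units.inv_mul, mul_one, ← map_mul, mul_inv_cancel, map_one, mul_one,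
                      Units.mul_inv]
    | zero => exact ⟨0, zero_mem _, by simp⟩
    | add y y' _ _ hy hy' =>
      obtain ⟨z, hz, h⟩ := hy
      obtain ⟨z', hz', h'⟩ := hy'
      exact ⟨z + z', add_mem hz hz', by simp only [mul_add, add_mul, star_add, h, h']⟩
    | smul c y _ hy =>
      obtain ⟨z, hz, h⟩ := hy
      refine ⟨star c • z, Submodule.smul_mem _ _ hz, ?_⟩
      simp only [mul_smul_comm, smul_mul_assoc, star_smul, h]
  have htr' : ∀ y ∈ Submodule.span k (Set.range ρ), (x * y).trace = 0 := by
    intro y hy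
    induction hy using Submodule.span_induction with
    | mem y hy =>
      obtain ⟨h, rfl⟩ := hy
      exact htr h
    | zero => simp
    | add y y' _ _ hy hy' => rw [mul_add, trace_add, hy, hy', add_zero]
    | smul c y _ hy => rw [mul_smul_comm, trace_smul, hy, smul_zero]
  obtain ⟨z, hz, h⟩ := hstar x hx
  have h0 : (((T : Matrix n n k) * x * (T⁻¹ : (Matrix n n k)ˣ)) *
      star ((T : Matrix n n k) * x * (T⁻¹ : (Matrix n n k)ˣ))).trace = 0 := by
    rw [h]
    have : (T : Matrix n n k) * x * (T⁻¹ : (Matrix n n k)ˣ) *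
        ((T : Matrix n n k) * z * (T⁻¹ : (Matrix n n k)ˣ)) =
        (T : Matrix n n k) * (x * (((T⁻¹ : (Matrix n n k)ˣ) : Matrix n n k) * T) * z *
          ((T⁻¹ : (Matrix n n k)ˣ) : Matrix n n k)) := by
      simp only [mul_assoc]
    rw [this, trace_mul_comm, Units.inv_mul, mul_one, mul_assoc, Units.inv_mul, mul_one,
      htr' z hz]
  open scoped ComplexOrder in rw [star_eq_conjTranspose, trace_mul_conjTranspose_self_eq_zero_iff] at h0
  exact T.mul_right_eq_zero.1 (T⁻¹.mul_left_eq_zero.1 h0)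

end Matrix

/-! ### Matrix coefficients from translates of regular functions. -/

section Translates

variable {k G : Type*} [Field k] [Group G]

/-- A family of functions on a group whose right translates lie in a finite-dimensional space
consists of matrix coefficients of a single representation. -/
theorem exists_matrixCoefficients {ι : Type*} (f : ι → G → k) (V : Submodule k (G → k))
    [FiniteDimensional k V] (hV : ∀ i h, (fun g => f i (g * h)) ∈ V) :
    ∃ (n : ℕ) (ρ : G →* Matrix (Fin n) (Fin n) k),
      ∀ i, ∃ φ : Matrix (Fin n) (Fin n) k →ₗ[k] k, ∀ g, f i g = φ (ρ g) := by
  let W : Submodule k (G → k) :=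
    Submodule.span k (Set.range fun x : ι × G => fun g => f x.1 (g * x.2))
  have hWV : W ≤ V := Submodule.span_le.2 (by rintro _ ⟨⟨i, h⟩, rfl⟩; exact hV i h)
  have : FiniteDimensional k W := Submodule.finiteDimensional_of_le hWV
  let τ : G → (G → k) →ₗ[k] (G → k) := fun h => LinearMap.funLeft k k (· * h)
  have hτ : ∀ h, ∀ w ∈ W, τ h w ∈ W := by
    intro h
    suffices W ≤ W.comap (τ h) from this
    refine Submodule.span_le.2 ?_
    rintro _ ⟨⟨i, h'⟩, rfl⟩
    refine Submodule.subset_span ⟨(i, h * h'), funext fun g => ?_⟩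
    simp [τ, LinearMap.funLeft_apply, mul_assoc]
  let σ : G →* Module.End k W :=
    { toFun := fun h => (τ h).restrict (hτ h)
      map_one' := by ext w g; simp [τ, LinearMap.funLeft_apply]
      map_mul' := fun h h' => by ext w g; simp [τ, LinearMap.funLeft_apply, mul_assoc] }
  let b := Module.finBasis k W
  refine ⟨_, (LinearMap.toMatrixAlgEquiv b).toAlgHom.toRingHom.toMonoidHom.comp σ, fun i => ?_⟩
  let w : W := ⟨f i, Submodule.subset_span ⟨(i, 1), by simp⟩⟩
  -- The coefficient applies the endomorphism to `f i` and evaluates at `1`: the translate of `f i`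
  -- by `g` takes the value `f i g` there.
  refine ⟨LinearMap.proj 1 ∘ₗ W.subtype ∘ₗ LinearMap.applyₗ w ∘ₗ
    (LinearMap.toMatrixAlgEquiv b).symm.toLinearMap, fun g => ?_⟩
  have : (LinearMap.toMatrixAlgEquiv b).symm (LinearMap.toMatrixAlgEquiv b (σ g)) = σ g :=
    AlgEquiv.symm_apply_apply _ _
  change f i g =
    (((LinearMap.toMatrixAlgEquiv b).symm (LinearMap.toMatrixAlgEquiv b (σ g)) w : W) : G → k) 1
  rw [this]
  simp [σ, τ, w, LinearMap.funLeft_apply]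

end Translates

namespace RationalPoints

variable {k A : Type*} [Field k] [CommRing A] [HopfAlgebra k A]

/-- Finitely many regular functions on an affine algebraic group are matrix coefficients of a
single representation of a given group of rational points. -/
theorem exists_matrixCoefficients (Γ : Subgroup (RationalPoints k A)) (s : Finset A) :
    ∃ (n : ℕ) (ρ : Γ →* Matrix (Fin n) (Fin n) k),
      ∀ a ∈ s, ∃ φ : Matrix (Fin n) (Fin n) k →ₗ[k] k,
        ∀ g : Γ, (g : RationalPoints k A).ofConv a = φ (ρ g) := by
  let ev : A → Γ → k := fun a g => (g : RationalPoints k A).ofConv a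
  -- If `Δ a = ∑ aᵢ ⊗ bᵢ`, then `a (g h) = ∑ bᵢ(h) aᵢ(g)`, so the left factors `aᵢ` span all right
  -- translates of `a`.
  let V : Submodule k (Γ → k) :=
    Submodule.span k (⋃ a ∈ s, (fun i => ev ((Coalgebra.Repr.arbitrary k a).left i)) ''
      (Coalgebra.Repr.arbitrary k a).index)
  have hfin : (⋃ a ∈ s, (fun i => ev ((Coalgebra.Repr.arbitrary k a).left i)) ''
      ((Coalgebra.Repr.arbitrary k a).index : Set (A × A))).Finite :=
    s.finite_toSet.biUnion fun a _ => (Finset.finite_toSet _).image _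
  have : FiniteDimensional k V := FiniteDimensional.span_of_finite k hfin
  obtain ⟨n, ρ, h⟩ := _root_.exists_matrixCoefficients (fun a : s => ev a) V (by
    rintro ⟨a, ha⟩ h
    have h1 : (fun g => ev a (g * h)) = ∑ i ∈ (Coalgebra.Repr.arbitrary k a).index,
        (h : RationalPoints k A).ofConv ((Coalgebra.Repr.arbitrary k a).right i) •
          ev ((Coalgebra.Repr.arbitrary k a).left i) := by
      funext g
      have h2 := (Coalgebra.Repr.arbitrary k a).convMul_apply
        (WithConv.toConv (g : RationalPoints k A).ofConv.toLinearMap)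
        (WithConv.toConv (h : RationalPoints k A).ofConv.toLinearMap)
      rw [← AlgHom.toLinearMap_convMul] at h2
      refine h2.trans ?_
      rw [Finset.sum_apply]
      exact Finset.sum_congr rfl fun i _ => mul_comm _ _
    change (fun g => ev a (g * h)) ∈ V
    rw [h1]
    refine Submodule.sum_mem _ fun i hi => Submodule.smul_mem _ _ (Submodule.subset_span ?_)
    exact Set.mem_biUnion (Finset.mem_coe.2 ha) ⟨i, hi, rfl⟩)
  exact ⟨n, ρ, fun a ha => h ⟨a, ha⟩⟩

end RationalPoints

/-! ### Boundedness of torsion groups and accumulation at the identity. -/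

namespace Matrix

open Filter Topology

variable {k : Type*} [RCLike k] {n : Type*} [Fintype n] [DecidableEq n]

/-- Torsion groups of real or complex matrices are bounded. -/
theorem exists_norm_le_of_isMulTorsion {G : Type*} [Group G] (hG : IsMulTorsion G)
    (ρ : G →* Matrix n n k) (hρ : Function.Injective ρ) :
    ∃ M : ℝ, ∀ g i j, ‖ρ g i j‖ ≤ M := by
  obtain ⟨S, hS, hspan⟩ := exists_finite_span_image_eq ρ hρ
  let H := Subgroup.closure S
  have : Group.FG H := (Group.fg_iff_subgroup_fg H).2 ⟨hS.toFinset, by simp [H]⟩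
  have : Finite H := finite_of_isMulTorsion_of_fg (hG.subgroup H) (ρ.comp H.subtype)
    (hρ.comp Subtype.val_injective)
  have := hS.fintype
  let V := Submodule.span k (Set.range ρ)
  have hV : V ≤ Submodule.span k (Set.range (ρ.comp H.subtype)) := by
    refine hspan.ge.trans (Submodule.span_mono ?_)
    rintro _ ⟨s, hs, rfl⟩
    exact ⟨⟨s, Subgroup.subset_closure hs⟩, rfl⟩
  -- `Φ` is injective: vanishing against `S` means vanishing against the span, hence against the
  -- finite group `H`, where the trace form is nondegenerate. A left inverse recovers matrix entries
  -- from traces.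
  let Φ : V →ₗ[k] (S → k) := LinearMap.pi fun s =>
    traceLinearMap n k k ∘ₗ LinearMap.mulRight k (ρ s) ∘ₗ V.subtype
  have hΦ : LinearMap.ker Φ = ⊥ := by
    refine LinearMap.ker_eq_bot'.2 fun x hx => Subtype.ext ?_
    have hx' : ∀ y ∈ V, ((x : Matrix n n k) * y).trace = 0 := by
      change ∀ y ∈ Submodule.span k (Set.range ρ), _
      rw [← hspan]
      intro y hy
      induction hy using Submodule.span_induction with
      | mem y hy =>
        obtain ⟨s, hs, rfl⟩ := hy
        exact congrFun hx ⟨s, hs⟩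
      | zero => simp
      | add y y' _ _ hy hy' => rw [mul_add, trace_add, hy, hy', add_zero]
      | smul c y _ hy => rw [mul_smul_comm, trace_smul, hy, smul_zero]
    exact eq_zero_of_mem_span_of_trace_mul_eq_zero (ρ.comp H.subtype) (hV x.2)
      fun h => hx' _ (Submodule.subset_span ⟨_, rfl⟩)
  obtain ⟨Ψ, hΨ⟩ := LinearMap.exists_leftInverse_of_injective Φ hΦ
  let L : n → n → (S → k) →L[k] k := fun i j =>
    LinearMap.toContinuousLinearMap (entryLinearMap k k i j ∘ₗ V.subtype ∘ₗ Ψ)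
  refine ⟨∑ i, ∑ j, ‖L i j‖ * Fintype.card n, fun g i j => ?_⟩
  let x : V := ⟨ρ g, Submodule.subset_span ⟨g, rfl⟩⟩
  have hx : ρ g i j = L i j (Φ x) := by
    have h : Ψ (Φ x) = x := LinearMap.congr_fun hΨ x
    change ρ g i j = (Ψ (Φ x) : Matrix n n k) i j
    rw [h]
  have hnorm : ‖Φ x‖ ≤ Fintype.card n := by
    refine (pi_norm_le_iff_of_nonneg (Nat.cast_nonneg _)).2 fun s => ?_
    change ‖(ρ g * ρ s).trace‖ ≤ _
    rw [← map_mul]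
    exact norm_trace_le_card_of_isOfFinOrder hG ρ _
  calc ‖ρ g i j‖ ≤ ‖L i j‖ * Fintype.card n := by
        rw [hx]
        exact (L i j).le_opNorm_of_le hnorm
    _ ≤ ∑ j, ‖L i j‖ * Fintype.card n :=
        Finset.single_le_sum (f := fun j => ‖L i j‖ * (Fintype.card n : ℝ))
          (fun _ _ => by positivity) (Finset.mem_univ j)
    _ ≤ ∑ i, ∑ j, ‖L i j‖ * Fintype.card n :=
        Finset.single_le_sum (f := fun i => ∑ j, ‖L i j‖ * (Fintype.card n : ℝ))
          (fun _ _ => by positivity) (Finset.mem_univ i)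

/-- An infinite bounded group of real or complex matrices contains a sequence of nontrivial
elements tending to the identity. -/
theorem exists_seq_tendsto_one {G : Type*} [Group G] [Infinite G] (ρ : G →* Matrix n n k)
    {M : ℝ} (hM : ∀ g i j, ‖ρ g i j‖ ≤ M) :
    ∃ u : ℕ → G, (∀ m, u m ≠ 1) ∧ Tendsto (fun m => ρ (u m)) atTop (𝓝 1) := by
  let C : Set (n → n → k) := Set.univ.pi fun _ => Set.univ.pi fun _ => Metric.closedBall 0 M
  have hC : IsCompact C :=
    isCompact_univ_pi fun _ => isCompact_univ_pi fun _ => isCompact_closedBall 0 M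
  have hmem : ∀ g, (ρ g : n → n → k) ∈ C := fun g i _ j _ => by
    simpa using hM g i j
  let f : ℕ ↪ G := Infinite.natEmbedding G
  -- Taking limits of elements and inverses together makes the limit `X` invertible, so quotients of
  -- consecutive terms tend to `X * Y = 1`.
  obtain ⟨⟨x, y⟩, -, ψ, hψ, hlim⟩ := (hC.prod hC).tendsto_subseq
    (X := (n → n → k) × (n → n → k)) (x := fun m => (ρ (f m), ρ (f m)⁻¹))
    fun m => ⟨hmem _, hmem _⟩
  let X : Matrix n n k := x
  let Y : Matrix n n k := y
  have hx : Tendsto (fun m => ρ (f (ψ m))) atTop (𝓝 X) :=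
    (continuous_fst.tendsto _).comp hlim
  have hy : Tendsto (fun m => ρ (f (ψ m))⁻¹) atTop (𝓝 Y) :=
    (continuous_snd.tendsto _).comp hlim
  have hxy : X * Y = 1 := by
    refine tendsto_nhds_unique (hx.mul hy) ?_
    simp only [← map_mul, mul_inv_cancel, map_one]
    exact tendsto_const_nhds
  refine ⟨fun m => f (ψ (m + 1)) * (f (ψ m))⁻¹, fun m h => ?_, ?_⟩
  · have := hψ.injective (f.injective (mul_inv_eq_one.1 h))
    omega
  · have := ((hx.comp (tendsto_add_atTop_nat 1)).mul hy)
    rw [hxy] at this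
    refine this.congr fun m => ?_
    simp

end Matrix

/-! ### Groups of rational points. -/

namespace RationalPoints

open Filter Topology

variable {k A : Type*} [Field k] [CommRing A] [HopfAlgebra k A]

/-- A group of rational points has a faithful representation with prescribed matrix
coefficients. -/
theorem exists_injective_rep [Algebra.FiniteType k A] (Γ : Subgroup (RationalPoints k A)) :
    ∃ (s : Finset A) (n : ℕ) (ρ : Γ →* Matrix (Fin n) (Fin n) k),
      Algebra.adjoin k (s : Set A) = ⊤ ∧ Function.Injective ρ ∧
      ∀ a ∈ s, ∃ φ : Matrix (Fin n) (Fin n) k →ₗ[k] k,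
        ∀ g : Γ, (g : RationalPoints k A).ofConv a = φ (ρ g) := by
  obtain ⟨s, hs⟩ := (Algebra.FiniteType.out : (⊤ : Subalgebra k A).FG)
  obtain ⟨n, ρ, h⟩ := exists_matrixCoefficients Γ s
  refine ⟨s, n, ρ, hs, fun g g' hgg' => ?_, h⟩
  refine Subtype.ext (WithConv.ext (AlgHom.ext_of_adjoin_eq_top hs fun a ha => ?_))
  obtain ⟨φ, hφ⟩ := h a ha
  rw [hφ, hφ, hgg']

/-- Convergence of rational points can be tested on algebra generators. -/
theorem tendsto_iff_of_adjoin_eq_top [TopologicalSpace k] [IsTopologicalRing k] {s : Set A}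
    (hs : Algebra.adjoin k s = ⊤) {α : Type*} {l : Filter α} {u : α → RationalPoints k A}
    {x : RationalPoints k A} :
    Tendsto u l (𝓝 x) ↔ ∀ a ∈ s, Tendsto (fun m => (u m).ofConv a) l (𝓝 (x.ofConv a)) := by
  rw [(IsInducing.induced
    (fun (g : RationalPoints k A) (a : A) => g.ofConv a)).tendsto_nhds_iff, tendsto_pi_nhds]
  refine ⟨fun h a _ => h a, fun h a => ?_⟩
  have ha : a ∈ Algebra.adjoin k s := hs ▸ Algebra.mem_top
  change Tendsto (fun m => (u m).ofConv a) l (𝓝 (x.ofConv a))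
  induction ha using Algebra.adjoin_induction with
  | mem a ha => exact h a ha
  | algebraMap r => simpa using tendsto_const_nhds
  | add a b _ _ ha hb => simpa using ha.add hb
  | mul a b _ _ ha hb => simpa using ha.mul hb

/-- Discrete torsion groups of rational points over `ℝ` or `ℂ` are finite. -/
theorem finite_of_discreteTopology_of_isMulTorsion {k A : Type*} [RCLike k] [CommRing A]
    [HopfAlgebra k A] [Algebra.FiniteType k A] (Γ : Subgroup (RationalPoints k A))
    [DiscreteTopology Γ] (hΓ : IsMulTorsion Γ) : Finite Γ := by
  by_contra hinf
  rw [not_finite_iff_infinite] at hinf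
  obtain ⟨s, n, ρ, hs, hρ, hφ⟩ := exists_injective_rep Γ
  obtain ⟨M, hM⟩ := Matrix.exists_norm_le_of_isMulTorsion hΓ ρ hρ
  obtain ⟨u, hu, hlim⟩ := Matrix.exists_seq_tendsto_one ρ hM
  -- Generators of `A` are linear in `ρ`, so convergence of the matrices forces convergence of the
  -- points, though nothing is known about continuity of `ρ`.
  have h1 : Tendsto u atTop (𝓝 1) := by
    rw [tendsto_subtype_rng, tendsto_iff_of_adjoin_eq_top hs]
    intro a ha
    obtain ⟨φ, h⟩ := hφ a ha
    simp only [h]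
    rw [map_one]
    have hc : Continuous φ := LinearMap.continuous_of_finiteDimensional φ
    exact (hc.tendsto 1).comp hlim
  rw [nhds_discrete, tendsto_pure] at h1
  obtain ⟨m, hm⟩ := h1.exists
  exact hu m hm

end RationalPoints

theorem lemma3p1 :
    -- the `p`-adic case: `k` is a finite extension of `ℚ_p`, `G = Spec A`
    (∀ (p : ℕ) [Fact p.Prime] (k : Type*) [Field k] [Algebra ℚ_[p] k] [FiniteDimensional ℚ_[p] k]
        (A : Type*) [CommRing A] [HopfAlgebra k A] [Algebra.FiniteType k A]
        (Γ : Subgroup (RationalPoints k A)),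
        IsMulTorsion Γ → Finite Γ) ∧
    -- the real and complex cases
    (∀ (k : Type*) [RCLike k]
        (A : Type*) [CommRing A] [HopfAlgebra k A] [Algebra.FiniteType k A]
        (Γ : Subgroup (RationalPoints k A)),
        DiscreteTopology Γ → IsMulTorsion Γ → Finite Γ) := by
  refine ⟨fun p _ k _ _ _ A _ _ _ Γ hΓ => ?_, fun k _ A _ _ _ Γ _ hΓ =>
    RationalPoints.finite_of_discreteTopology_of_isMulTorsion Γ hΓ⟩
  obtain ⟨_, _, ρ, _, hρ, _⟩ := RationalPoints.exists_injective_rep Γ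
  exact Matrix.finite_of_isMulTorsion_of_padic p hΓ ρ hρ
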